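/- **Setting.** Let $I_0\subset\mathbb R^D$ be compact with diameter $1$ and non-empty interior, and let $0<\tau<1$. A set $J\subseteq I$ is an $r$-similarity of $I$ if $J=S(I)$ for a similarity $S$ of ratio $r$; a family of $r$-similarities $J_1,\dots,J_t$ of $I$ is $\tau$-separated if $d(J_i,J_j)\ge \tau\, r\,\mathrm{diam}(I)$ for $i\ne j$. For each $t\ge 2$ let $r_t\in(0,1/2]$ be such that for every $0<r\le r_t$ there exist $t$ $\tau$-separated $r$-similarities of $I_0$. Put $\mathcal S_t=\{x\in\mathbb R^t: x_i>0,\ \sum_i x_i=1\}$ and $\Omega_0=\bigsqcup_{t\ge2}(0,r_t]\times\mathcal S_t$. Let $\pi$ be a Borel probability measure on $\Omega_0$ and $\mathbb P=\pi^{\otimes\mathbb N}$ on $\Omega=\Omega_0^{\mathbb N}$. For $\omega\in\Omega$ write $(T_n,r_n,p_n)$, $n\ge1$, for the i.i.d. numbers of children, ratios and probability vectors that $\omega$ determines, and put $M_n=\max_j p_n^{(j)}$, $m_n=\min_j p_n^{(j)}$. Assume that there is $A>0$ with $\mathbb E(e^{-\lambda\log r_1})<\infty$ for all $|\lambda|\le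 A$. Given $\omega$, start from $I_0$ and inductively select, inside each Moran set $I$ of step $n$, $T_{n+1}$ $\tau$-separated $r_{n+1}$-similarities $I^{(1)},\dots,I^{(T_{n+1})}$ of $I$, the Moran sets of step $n+1$ in $I$. The random Moran measure $\mu_\omega$ is the Borel probability measure supported on $E(\omega)=\bigcap_n\bigcup\{\text{Moran sets of step }n\}$ with $\mu_\omega(I_0)=1$ and $\mu_\omega(I^{(j)})=\mu_\omega(I)\,p_{n+1}^{(j)}$. A dimension function is a map $\Phi:(0,1)\to[0,\infty)$ such that $x^{1+\Phi(x)}$ decreases to $0$ as $x$ decreases to $0$. It is small if there are $\delta>0$ and a function $A$ with $A(x)\to\infty$ as $x\to0^+$ such that $A(x)\Phi(x)\le \log|\log x|/|\log x|$ for $0<x<\delta$. The upper $\Phi$-dimension $\overline{\dim}_\Phi\mu$ is the infimum in $[-\infty,\infty]$ of the real $d$ for which there are $C_1,C_2>0$ such that $\mu(B(x,R))/\mu(B(x,r))\le C_2(R/r)^d$ whenever $0<r<R^{1+\Phi(R)}\le R\le C_1$ and $x\in\mathrm{supp}\,\mu$; the lower $\Phi$-dimension $\underline{\dim}_\Phi\mu$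 is the supremum of the real $d$ for which the same holds with $\ge$ in place of $\le$ in the inequality for the measures. The Assouad dimension $\dim_A\mu$ and lower Assouad dimension $\dim_L\mu$ are the upper and lower $\Phi$-dimensions for $\Phi\equiv0$. Finally let $$\alpha=\operatorname{ess\,sup}\frac{\log m_1}{\log r_1}\in[0,\infty],\qquad \beta=\operatorname{ess\,inf}\frac{\log M_1}{\log r_1}.$$ **Statement.** (1) If $\operatorname{ess\,inf} r_1>0$, then for $\mathbb P$-almost every $\omega$, for every choice of the Moran sets and all small dimension functions $\Phi$, $$\underline{\dim}_\Phi\mu_\omega=\dim_L\mu_\omega=\beta\quad\text{and}\quad\overline{\dim}_\Phi\mu_\omega=\dim_A\mu_\omega=\alpha .$$ (2) If the number of children is bounded (there is $K$ with $T_1\le K$ almost surely), then for $\mathbb P$-almost every $\omega$, for every choice of the Moran sets and all small dimension functions $\Phi$, $$\underline{\dim}_\Phi\mu_\omega=\dim_L\mu_\omega=\beta .$$ -/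

import Mathlib

open MeasureTheory Filter Topology

/-! ### Dimension functions and the upper and lower `Φ`-dimensions of a measure -/

/-- A dimension function is a map `Φ : (0,1) → [0,∞)` such that `x ^ (1 + Φ x)` decreases to `0`
as `x` decreases to `0`. Only the values of `Φ` on `(0,1)` are relevant. -/
def IsDimensionFunction (Φ : ℝ → ℝ) : Prop :=
  (∀ x ∈ Set.Ioo (0 : ℝ) 1, 0 ≤ Φ x) ∧
  MonotoneOn (fun x : ℝ => x ^ (1 + Φ x)) (Set.Ioo 0 1) ∧
  Tendsto (fun x : ℝ => x ^ (1 + Φ x)) (𝓝[>] 0) (𝓝 0)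

/-- `f ≫ g`: there are `A` and `δ > 0` such that `f x ≥ A x * g x` for `0 < x < δ` (and `x < 1`,
where the functions are defined), and `A x → ∞` as `x → 0⁺`. -/
def MuchLarger (f g : ℝ → ℝ) : Prop :=
  ∃ A : ℝ → ℝ, ∃ δ : ℝ, 0 < δ ∧ Tendsto A (𝓝[>] 0) atTop ∧
    ∀ x : ℝ, 0 < x → x < δ → x < 1 → A x * g x ≤ f x

/-- A function `Φ` is small if `Φ x ≪ log |log x| / |log x|`. -/
def IsSmall (Φ : ℝ → ℝ) : Prop :=
  MuchLarger (fun x => Real.log |Real.log x| / |Real.log x|) Φ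

section PhiDimension

variable {X : Type*} [PseudoMetricSpace X] [MeasurableSpace X]

/-- The upper `Φ`-dimension of `μ`; it is `⊤` if no exponent `d` is admissible. -/
noncomputable def upperPhiDim (Φ : ℝ → ℝ) (μ : Measure X) : EReal :=
  sInf ((fun d : ℝ => (d : EReal)) '' {d : ℝ | ∃ C₁ C₂ : ℝ, 0 < C₁ ∧ C₁ < 1 ∧ 0 < C₂ ∧
    ∀ r R : ℝ, 0 < r → r < R ^ (1 + Φ R) → R ^ (1 + Φ R) ≤ R → 0 < R → R ≤ C₁ →
      ∀ x ∈ μ.support,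
        μ.real (Metric.ball x R) / μ.real (Metric.ball x r) ≤ C₂ * (R / r) ^ d})

/-- The lower `Φ`-dimension of `μ`. -/
noncomputable def lowerPhiDim (Φ : ℝ → ℝ) (μ : Measure X) : EReal :=
  sSup ((fun d : ℝ => (d : EReal)) '' {d : ℝ | ∃ C₁ C₂ : ℝ, 0 < C₁ ∧ C₁ < 1 ∧ 0 < C₂ ∧
    ∀ r R : ℝ, 0 < r → r < R ^ (1 + Φ R) → R ^ (1 + Φ R) ≤ R → 0 < R → R ≤ C₁ →
      ∀ x ∈ μ.support,
        C₂ * (R / r) ^ d ≤ μ.real (Metric.ball x R) / μ.real (Metric.ball x r)})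

/-- The (upper) Assouad dimension of a measure. -/
noncomputable def assouadDim (μ : Measure X) : EReal := upperPhiDim (fun _ => 0) μ

/-- The lower Assouad dimension of a measure. -/
noncomputable def lowerAssouadDim (μ : Measure X) : EReal := lowerPhiDim (fun _ => 0) μ

end PhiDimension

/-! ### Separated families of similar copies -/

/-- `J` is an `r`-similarity of `I`: a subset of `I` which is the image of `I` under a similarity
of ratio `r`. -/
def IsSimilarCopy {D : ℕ} (r : ℝ) (I J : Set (EuclideanSpace ℝ (Fin D))) : Prop :=
  J ⊆ I ∧ ∃ S : EuclideanSpace ℝ (Fin D) → EuclideanSpace ℝ (Fin D),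
    (∀ x y, dist (S x) (S y) = r * dist x y) ∧ J = S '' I

/-- The family `J` consists of `r`-similarities of `I` and is `τ`-separated: two different members
are at distance at least `τ * r * diam I`. -/
def IsSeparatedFamily {D t : ℕ} (τ r : ℝ) (I : Set (EuclideanSpace ℝ (Fin D)))
    (J : Fin t → Set (EuclideanSpace ℝ (Fin D))) : Prop :=
  (∀ i, IsSimilarCopy r I (J i)) ∧
  ∀ i j, i ≠ j → ∀ x ∈ J i, ∀ y ∈ J j, τ * r * Metric.diam I ≤ dist x y

/-- The `(t, r, τ)`-separation property of `I`. -/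
def HasSeparationProperty {D : ℕ} (I : Set (EuclideanSpace ℝ (Fin D))) (t : ℕ) (r τ : ℝ) : Prop :=
  ∃ J : Fin t → Set (EuclideanSpace ℝ (Fin D)), IsSeparatedFamily τ r I J

/-! ### The random set-up -/

/-- The fixed data: a compact set `I₀ ⊆ ℝ^D` of diameter `1` with non-empty interior, a number
`0 < τ < 1`, and for each `t ≥ 2` a number `r_t ∈ (0, 1/2]` such that `I₀` has the
`(t, r, τ)`-separation property for all `0 < r ≤ r_t`. -/
structure MoranData (D : ℕ) where
  I₀ : Set (EuclideanSpace ℝ (Fin D))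
  isCompact : IsCompact I₀
  diam_eq : Metric.diam I₀ = 1
  interior_nonempty : (interior I₀).Nonempty
  τ : ℝ
  τ_pos : 0 < τ
  τ_lt_one : τ < 1
  rbar : ℕ → ℝ
  rbar_pos : ∀ t, 2 ≤ t → 0 < rbar t
  rbar_le : ∀ t, 2 ≤ t → rbar t ≤ 1 / 2
  separation : ∀ t, 2 ≤ t → ∀ r, 0 < r → r ≤ rbar t → HasSeparationProperty I₀ t r τ

namespace MoranData

variable {D : ℕ} (S : MoranData D)

/-- The space `Ω_t = (0, r_t] × 𝒮_t` for `t ≥ 2`, where `𝒮_t` is the open probability simplex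
(it is empty for `t < 2`). -/
abbrev OmegaT (t : ℕ) : Type :=
  {w : ℝ × (Fin t → ℝ) // 2 ≤ t ∧ (0 < w.1 ∧ w.1 ≤ S.rbar t) ∧
    (∀ i, 0 < w.2 i) ∧ ∑ i, w.2 i = 1}

/-- The one-step sample space `Ω₀`, the disjoint union of the `Ω_t`, `t ≥ 2`, with its Borel
`σ`-algebra. -/
abbrev Omega₀ : Type := Σ t : ℕ, S.OmegaT t

variable {S}

/-- The number of children. -/
def T (w : S.Omega₀) : ℕ := w.1

/-- The ratio of the diameter of a child to that of its parent. -/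
def ratio (w : S.Omega₀) : ℝ := w.2.1.1

/-- The probability vector. -/
def prob (w : S.Omega₀) (j : Fin (T w)) : ℝ := w.2.1.2 j

/-- The largest probability. -/
noncomputable def maxProb (w : S.Omega₀) : ℝ := ⨆ j, prob w j

/-- The smallest probability. -/
noncomputable def minProb (w : S.Omega₀) : ℝ := ⨅ j, prob w j

/-- `α`, the essential supremum of `log m₁ / log r₁`, possibly infinite. -/
noncomputable def alpha (π : Measure S.Omega₀) : EReal :=
  essSup (fun w => ((Real.log (minProb w) / Real.log (ratio w) : ℝ) : EReal)) π

/-- `β`, the essential infimum of `log M₁ / log r₁`. -/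
noncomputable def beta (π : Measure S.Omega₀) : EReal :=
  essInf (fun w => ((Real.log (maxProb w) / Real.log (ratio w) : ℝ) : EReal)) π

/-- The probability measure on `{1, …, T w}` given by the probability vector of `w`. -/
noncomputable def stepMeasure (w : S.Omega₀) : Measure (Fin (T w)) :=
  ∑ j, ENNReal.ofReal (prob w j) • Measure.dirac j

lemma prob_pos (w : S.Omega₀) (j : Fin (T w)) : 0 < prob w j := w.2.2.2.2.1 j

lemma sum_prob (w : S.Omega₀) : ∑ j, prob w j = 1 := w.2.2.2.2.2

lemma two_le_T (w : S.Omega₀) : 2 ≤ T w := w.2.2.1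

lemma ratio_pos (w : S.Omega₀) : 0 < ratio w := w.2.2.2.1.1

lemma ratio_le_half (w : S.Omega₀) : ratio w ≤ 1 / 2 :=
  w.2.2.2.1.2.trans (S.rbar_le _ w.2.2.1)

lemma stepMeasure_singleton (w : S.Omega₀) (j : Fin (T w)) :
    stepMeasure w {j} = ENNReal.ofReal (prob w j) := by
  classical
  simp [stepMeasure, Measure.finsetSum_apply, Set.indicator_apply, Finset.sum_ite_eq']

instance (w : S.Omega₀) : IsProbabilityMeasure (stepMeasure w) := by
  constructor
  simp only [stepMeasure, Measure.finsetSum_apply, Measure.smul_apply, measure_univ, smul_eq_mul,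
    mul_one]
  rw [← ENNReal.ofReal_sum_of_nonneg (fun j _ => (prob_pos w j).le), sum_prob, ENNReal.ofReal_one]

/-- The infinite branches of the tree of labels determined by `ω`: at a vertex of level `n` one
chooses one of the `T (ω n)` children. (The steps are numbered from `0`.) -/
abbrev Branch (ω : ℕ → S.Omega₀) : Type := ∀ n : ℕ, Fin (T (ω n))

/-- A choice, made inductively, of the Moran sets of all levels for a given `ω`. The set
`cell n b` is the Moran set of step `n` whose label consists of the first `n` entries of `b`; its
children are the sets `cell (n + 1) (Function.update b n j)`, for `j` among `T (ω n)` indices. -/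
structure Construction (ω : ℕ → S.Omega₀) where
  cell : ℕ → Branch ω → Set (EuclideanSpace ℝ (Fin D))
  cell_congr : ∀ n b b', (∀ i < n, b i = b' i) → cell n b = cell n b'
  cell_zero : ∀ b, cell 0 b = S.I₀
  children : ∀ n b, IsSeparatedFamily S.τ (ratio (ω n)) (cell n b)
    (fun j : Fin (T (ω n)) => cell (n + 1) (Function.update b n j))

namespace Construction

variable {ω : ℕ → S.Omega₀} (C : Construction ω)

lemma isSimilarCopy (n : ℕ) (b : Branch ω) :
    IsSimilarCopy (ratio (ω n)) (C.cell n b) (C.cell (n + 1) b) := by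
  have h : IsSimilarCopy (ratio (ω n)) (C.cell n b) (C.cell (n + 1) (Function.update b n (b n))) :=
    (C.children n b).1 (b n)
  rwa [Function.update_eq_self] at h

lemma isCompact_cell (n : ℕ) (b : Branch ω) : IsCompact (C.cell n b) := by
  induction n with
  | zero => rw [C.cell_zero]; exact S.isCompact
  | succ n ih =>
    obtain ⟨-, f, hf, he⟩ := C.isSimilarCopy n b
    rw [he]
    refine ih.image (LipschitzWith.of_dist_le_mul (K := (ratio (ω n)).toNNReal) ?_).continuous
    intro x y
    rw [hf, Real.coe_toNNReal _ (ratio_pos _).le]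

lemma nonempty_cell (n : ℕ) (b : Branch ω) : (C.cell n b).Nonempty := by
  induction n with
  | zero => rw [C.cell_zero]; exact S.interior_nonempty.mono interior_subset
  | succ n ih =>
    obtain ⟨-, f, -, he⟩ := C.isSimilarCopy n b
    rw [he]
    exact ih.image f

lemma exists_mem_cell (b : Branch ω) : ∃ x, ∀ n, x ∈ C.cell n b := by
  have h := IsCompact.nonempty_iInter_of_sequence_nonempty_isCompact_isClosed
    (fun n => C.cell n b) (fun n => (C.isSimilarCopy n b).1) (fun n => C.nonempty_cell n b)
    (C.isCompact_cell 0 b) (fun n => (C.isCompact_cell n b).isClosed)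
  obtain ⟨x, hx⟩ := h
  exact ⟨x, fun n => Set.mem_iInter.1 hx n⟩

/-- The (unique) point of the random Moran set that lies in all the Moran sets along `b`. -/
noncomputable def point (b : Branch ω) : EuclideanSpace ℝ (Fin D) := (C.exists_mem_cell b).choose

lemma point_mem (b : Branch ω) (n : ℕ) : C.point b ∈ C.cell n b :=
  (C.exists_mem_cell b).choose_spec n

/-- The random Moran set: the intersection over `n` of the unions of the Moran sets of step `n`. -/
def moranSet : Set (EuclideanSpace ℝ (Fin D)) := ⋂ n, ⋃ b, C.cell n b

/-- The random Moran measure: the image, under the coding map, of the product of the probability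
vectors of all steps on the space of branches. It is the Borel probability measure on the random
Moran set for which the `j`-th child of a Moran set of step `n` has the `j`-th probability of step
`n + 1` times the mass of its parent. -/
noncomputable def measure : Measure (EuclideanSpace ℝ (Fin D)) :=
  (Measure.infinitePi (fun n => stepMeasure (ω n))).map C.point

lemma diam_cell_le (n : ℕ) (b : Branch ω) : Metric.diam (C.cell n b) ≤ (1 / 2) ^ n := by
  induction n with
  | zero => rw [C.cell_zero, S.diam_eq, pow_zero]
  | succ n ih =>
    obtain ⟨-, f, hf, he⟩ := C.isSimilarCopy n b
    rw [he]
    refine Metric.diam_le_of_forall_dist_le (by positivity) ?_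
    rintro _ ⟨x, hx, rfl⟩ _ ⟨y, hy, rfl⟩
    rw [hf, pow_succ']
    exact mul_le_mul (ratio_le_half _)
      ((Metric.dist_le_diam_of_mem (C.isCompact_cell n b).isBounded hx hy).trans ih)
      dist_nonneg (by norm_num)

lemma diam_cell_pos (n : ℕ) (b : Branch ω) : 0 < Metric.diam (C.cell n b) := by
  have key : ∀ n, ∃ x ∈ C.cell n b, ∃ y ∈ C.cell n b, x ≠ y := by
    intro n
    induction n with
    | zero =>
      rw [C.cell_zero]
      by_contra! h
      have : S.I₀.Subsingleton := fun x hx y hy => h x hx y hy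
      have h1 := S.diam_eq
      rw [Metric.diam_subsingleton this] at h1
      norm_num at h1
    | succ n ih =>
      obtain ⟨x, hx, y, hy, hxy⟩ := ih
      obtain ⟨-, f, hf, he⟩ := C.isSimilarCopy n b
      refine ⟨f x, he ▸ ⟨x, hx, rfl⟩, f y, he ▸ ⟨y, hy, rfl⟩, ?_⟩
      rw [← dist_pos, hf]
      exact mul_pos (ratio_pos _) (dist_pos.2 hxy)
  obtain ⟨x, hx, y, hy, hxy⟩ := key n
  exact (dist_pos.2 hxy).trans_le
    (Metric.dist_le_diam_of_mem (C.isCompact_cell n b).isBounded hx hy)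

lemma continuous_point : Continuous C.point := by
  rw [continuous_iff_continuousAt]
  intro b
  rw [ContinuousAt, Metric.tendsto_nhds]
  intro ε hε
  obtain ⟨n, hn⟩ := exists_pow_lt_of_lt_one hε (by norm_num : (1 / 2 : ℝ) < 1)
  have hU : ∀ᶠ b' in 𝓝 b, ∀ i ∈ Finset.range n, b' i = b i := by
    rw [Filter.eventually_all_finset]
    intro i _
    exact (continuous_apply i).continuousAt.eventually
      ((isOpen_discrete ({b i} : Set (Fin (T (ω i))))).mem_nhds rfl)
  filter_upwards [hU] with b' hb'
  have h : C.cell n b' = C.cell n b :=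
    C.cell_congr n b' b fun i hi => hb' i (Finset.mem_range.2 hi)
  exact ((Metric.dist_le_diam_of_mem (C.isCompact_cell n b).isBounded
    (h ▸ C.point_mem b' n) (C.point_mem b n)).trans (C.diam_cell_le n b)).trans_lt hn

lemma disjoint_cell {n : ℕ} {b b' : Branch ω} (h : ∃ i < n, b i ≠ b' i) :
    Disjoint (C.cell n b) (C.cell n b') := by
  classical
  have anti : ∀ b, Antitone fun n => C.cell n b :=
    fun b => antitone_nat_of_succ_le fun n => (C.isSimilarCopy n b).1
  obtain ⟨hi, hne⟩ := Nat.find_spec h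
  have hmin : ∀ k < Nat.find h, b k = b' k := by
    intro k hk
    by_contra hc
    exact Nat.find_min h hk ⟨hk.trans hi, hc⟩
  set i := Nat.find h
  have e1 : C.cell (i + 1) b = C.cell (i + 1) (Function.update b i (b i)) := by
    rw [Function.update_eq_self]
  have e2 : C.cell (i + 1) b' = C.cell (i + 1) (Function.update b i (b' i)) := by
    refine C.cell_congr _ _ _ fun k hk => ?_
    rcases Nat.lt_succ_iff_lt_or_eq.1 hk with hk | rfl
    · rw [Function.update_of_ne hk.ne, hmin k hk]
    · rw [Function.update_self]
  refine Disjoint.mono (anti b hi) (anti b' hi) ?_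
  rw [Set.disjoint_left]
  intro x hx hx'
  have hd := (C.children i b).2 (b i) (b' i) hne x (e1.subset hx) x (e2.subset hx')
  rw [dist_self] at hd
  have := mul_pos (mul_pos S.τ_pos (ratio_pos (ω i))) (C.diam_cell_pos i b)
  linarith

instance : IsProbabilityMeasure C.measure :=
  Measure.isProbabilityMeasure_map C.continuous_point.measurable.aemeasurable

/-- The mass of a Moran set is the product of the probabilities along its label. -/
lemma measure_cell (n : ℕ) (b : Branch ω) :
    C.measure (C.cell n b) = ∏ i ∈ Finset.range n, ENNReal.ofReal (prob (ω i) (b i)) := by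
  have hpre : C.point ⁻¹' C.cell n b = Set.pi (Finset.range n) fun i => {b i} := by
    ext b'
    simp only [Set.mem_preimage, Set.mem_pi, Finset.coe_range, Set.mem_Iio, Set.mem_singleton_iff]
    constructor
    · intro hb' i hi
      by_contra hne
      exact Set.disjoint_left.1 (C.disjoint_cell ⟨i, hi, hne⟩) (C.point_mem b' n) hb'
    · intro hb'
      rw [← C.cell_congr n b' b hb']
      exact C.point_mem b' n
  rw [measure, Measure.map_apply C.continuous_point.measurable (C.isCompact_cell n b).measurableSet,
    hpre, Measure.infinitePi_pi _ (fun i _ => measurableSet_singleton _)]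
  simp only [stepMeasure_singleton]

/-- The support of the random Moran measure is the random Moran set. -/
lemma support_measure : C.measure.support = C.moranSet := by
  have hrange : C.moranSet = Set.range C.point := by
    ext x
    simp only [moranSet, Set.mem_iInter, Set.mem_iUnion, Set.mem_range]
    constructor
    · intro hx
      choose c hc using hx
      have hcc : ∀ n, x ∈ C.cell n (fun i => c (i + 1) i) := by
        intro n
        by_contra hn
        refine hn ?_
        rw [C.cell_congr n (fun i => c (i + 1) i) (c n)]
        · exact hc n
        · intro i hi
          by_contra hne
          have hm : x ∈ C.cell (i + 1) (c n) :=
            antitone_nat_of_succ_le (f := fun k => C.cell k (c n))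
              (fun k => (C.isSimilarCopy k (c n)).1) hi (hc n)
          exact Set.disjoint_left.1 (C.disjoint_cell ⟨i, i.lt_succ_self, hne⟩) (hc (i + 1)) hm
      refine ⟨fun i => c (i + 1) i, eq_of_forall_dist_le fun ε hε => ?_⟩
      obtain ⟨n, hn⟩ := exists_pow_lt_of_lt_one hε (by norm_num : (1 / 2 : ℝ) < 1)
      exact ((Metric.dist_le_diam_of_mem (C.isCompact_cell n _).isBounded
        (C.point_mem _ n) (hcc n)).trans (C.diam_cell_le n _)).trans hn.le
    · rintro ⟨b, rfl⟩ n
      exact ⟨b, C.point_mem b n⟩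
  have hclosed : IsClosed C.moranSet := by
    rw [hrange]
    exact (isCompact_range C.continuous_point).isClosed
  have hnull : C.measure C.moranSetᶜ = 0 := by
    rw [measure, Measure.map_apply C.continuous_point.measurable hclosed.measurableSet.compl,
      hrange, Set.preimage_compl, Set.preimage_range, Set.compl_univ, measure_empty]
  apply Set.Subset.antisymm
  · intro x hx
    by_contra hxE
    exact ((Measure.mem_support_iff_forall _).1 hx _ (hclosed.isOpen_compl.mem_nhds hxE)).ne' hnull
  · rw [hrange]
    rintro _ ⟨b, rfl⟩
    refine (Measure.mem_support_iff_forall _).2 fun U hU => ?_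
    obtain ⟨ε, hε, hεU⟩ := Metric.mem_nhds_iff.1 hU
    obtain ⟨n, hn⟩ := exists_pow_lt_of_lt_one hε (by norm_num : (1 / 2 : ℝ) < 1)
    have hpos : 0 < C.measure (C.cell n b) := by
      rw [C.measure_cell]
      exact pos_iff_ne_zero.2 (Finset.prod_ne_zero_iff.2 fun i _ =>
        (ENNReal.ofReal_pos.2 (prob_pos _ _)).ne')
    refine hpos.trans_le (measure_mono fun y hy => hεU ?_)
    exact ((Metric.dist_le_diam_of_mem (C.isCompact_cell n b).isBounded hy
      (C.point_mem b n)).trans (C.diam_cell_le n b)).trans_lt hn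

end Construction

end MoranData

/-! Write `scale ω n` for the common diameter of the step `n` cells and `branchMass b n` for the
mass of the cell along `b`. By separation, a ball about a coded point lies, as far as the measure
sees it, inside the step `n` cell when its radius is at most `τ * scale ω n`, and it contains that
cell when its radius exceeds `scale ω n`. So ratios of ball masses are ratios of cell masses up to
constants.

Uniform bounds: every step satisfies `ratio ^ α ≤ prob ≤ ratio ^ β`, up to approximation of the
exponents. If the ratios are bounded below, all radii are comparable to scales, and multiplying over
the steps gives `dim_L ≥ β` and `dim_A ≤ α` (`le_lowerAssouadDim_measure`, `assouadDim_measure_le`).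

Sharpness: by the second Borel–Cantelli lemma, nearly extremal steps occur infinitely often in runs
of length at least a constant times `log n` at position `n` (`exists_ae_frequently_run`). Such a run
shrinks the scale by a power of `n`. The law of large numbers gives `|log (scale ω n)| ≤ n ^ 2`, and
a small `Φ` has `R ^ Φ R ≥ |log R| ^ (-ε)`, so the run reaches below `R ^ (1 + Φ R)`
(`exists_run_of_isSmall`). Following the heaviest or the lightest children along it gives `β` as an
upper bound for the lower `Φ`-dimension and `α` as a lower bound for the upper one.

The Assouad dimensions bound the `Φ`-dimensions from outside, which closes the chains. With
boundedly many children and ratios not bounded below, `β ≤ 0 ≤ dim_L` replaces the uniform lower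
bound. -/

open MeasureTheory Filter Topology

/-! ### Scales, branch masses, and comparison of balls with cells. -/

namespace MoranData

variable {D : ℕ} {S : MoranData D}

/-- The common diameter of the Moran sets of step `n`. -/
noncomputable def scale (ω : ℕ → S.Omega₀) (n : ℕ) : ℝ := ∏ i ∈ Finset.range n, ratio (ω i)

/-- The mass of the Moran set of step `n` along the branch `b`. -/
noncomputable def branchMass {ω : ℕ → S.Omega₀} (b : Branch ω) (n : ℕ) : ℝ :=
  ∏ i ∈ Finset.range n, prob (ω i) (b i)

lemma scale_pos (ω : ℕ → S.Omega₀) (n : ℕ) : 0 < scale ω n :=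
  Finset.prod_pos fun _ _ => ratio_pos _

lemma scale_zero (ω : ℕ → S.Omega₀) : scale ω 0 = 1 := Finset.prod_range_zero _

lemma scale_succ (ω : ℕ → S.Omega₀) (n : ℕ) : scale ω (n + 1) = scale ω n * ratio (ω n) :=
  Finset.prod_range_succ _ _

lemma ratio_lt_one (w : S.Omega₀) : ratio w < 1 := (ratio_le_half w).trans_lt (by norm_num)

lemma log_ratio_neg (w : S.Omega₀) : Real.log (ratio w) < 0 :=
  Real.log_neg (ratio_pos w) (ratio_lt_one w)

lemma scale_strictAnti (ω : ℕ → S.Omega₀) : StrictAnti (scale ω) :=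
  strictAnti_nat_of_succ_lt fun n => by
    rw [scale_succ]
    exact mul_lt_of_lt_one_right (scale_pos ω n) (ratio_lt_one _)

lemma scale_add_le (ω : ℕ → S.Omega₀) (n L : ℕ) : scale ω (n + L) * 2 ^ L ≤ scale ω n := by
  induction L with
  | zero => simp
  | succ L ih =>
    refine le_trans ?_ ih
    rw [← add_assoc, scale_succ, pow_succ]
    have h := ratio_le_half (ω (n + L))
    have h1 : 0 < scale ω (n + L) * 2 ^ L := mul_pos (scale_pos _ _) (by positivity)
    nlinarith

lemma scale_le (ω : ℕ → S.Omega₀) (n : ℕ) : scale ω n ≤ (1 / 2) ^ n := by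
  have h := scale_add_le ω 0 n
  rw [zero_add, scale_zero] at h
  rwa [one_div, inv_pow, ← one_div, le_div_iff₀ (by positivity)]

lemma tendsto_scale (ω : ℕ → S.Omega₀) : Tendsto (scale ω) atTop (𝓝 0) :=
  squeeze_zero (fun n => (scale_pos ω n).le) (scale_le ω)
    (tendsto_pow_atTop_nhds_zero_of_lt_one (by norm_num) (by norm_num))

lemma branchMass_pos {ω : ℕ → S.Omega₀} (b : Branch ω) (n : ℕ) : 0 < branchMass b n :=
  Finset.prod_pos fun _ _ => prob_pos _ _

lemma nonempty_children (w : S.Omega₀) : Nonempty (Fin (T w)) :=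
  ⟨⟨0, (two_le_T w).trans_lt' (by norm_num)⟩⟩

lemma prob_lt_one (w : S.Omega₀) (j : Fin (T w)) : prob w j < 1 := by
  rw [← sum_prob w]
  have : Nontrivial (Fin (T w)) := Fin.nontrivial_iff_two_le.2 (two_le_T w)
  obtain ⟨k, hk⟩ := exists_ne j
  exact Finset.single_lt_sum hk (Finset.mem_univ _) (Finset.mem_univ _) (prob_pos w k)
    fun i _ _ => (prob_pos w i).le

lemma minProb_le (w : S.Omega₀) (j : Fin (T w)) : minProb w ≤ prob w j :=
  ciInf_le (Set.finite_range _).bddBelow j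

lemma le_maxProb (w : S.Omega₀) (j : Fin (T w)) : prob w j ≤ maxProb w :=
  le_ciSup (Set.finite_range _).bddAbove j

lemma exists_prob_eq_minProb (w : S.Omega₀) : ∃ j, prob w j = minProb w :=
  have := nonempty_children w
  exists_eq_ciInf_of_finite

lemma exists_prob_eq_maxProb (w : S.Omega₀) : ∃ j, prob w j = maxProb w :=
  have := nonempty_children w
  exists_eq_ciSup_of_finite

lemma minProb_pos (w : S.Omega₀) : 0 < minProb w := by
  obtain ⟨j, hj⟩ := exists_prob_eq_minProb w
  exact hj ▸ prob_pos w j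

lemma minProb_lt_one (w : S.Omega₀) : minProb w < 1 := by
  obtain ⟨j, hj⟩ := exists_prob_eq_minProb w
  exact hj ▸ prob_lt_one w j

lemma maxProb_pos (w : S.Omega₀) : 0 < maxProb w := by
  obtain ⟨j, hj⟩ := exists_prob_eq_maxProb w
  exact hj ▸ prob_pos w j

lemma one_le_T_mul_maxProb (w : S.Omega₀) : 1 ≤ T w * maxProb w := by
  rw [← sum_prob w]
  calc ∑ j, prob w j ≤ ∑ _j : Fin (T w), maxProb w := Finset.sum_le_sum fun j _ => le_maxProb w j
    _ = T w * maxProb w := by simp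

namespace Construction

variable {ω : ℕ → S.Omega₀} (C : Construction ω)

lemma diam_cell (n : ℕ) (b : Branch ω) : Metric.diam (C.cell n b) = scale ω n := by
  induction n with
  | zero => rw [C.cell_zero, S.diam_eq, scale_zero]
  | succ n ih =>
    obtain ⟨-, f, hf, he⟩ := C.isSimilarCopy n b
    have hr := ratio_pos (ω n)
    rw [scale_succ, ← ih]
    apply le_antisymm
    · rw [he]
      refine Metric.diam_le_of_forall_dist_le (by positivity) ?_
      rintro _ ⟨x, hx, rfl⟩ _ ⟨y, hy, rfl⟩
      rw [hf, mul_comm]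
      gcongr
      exact Metric.dist_le_diam_of_mem (C.isCompact_cell n b).isBounded hx hy
    · rw [← le_div_iff₀ hr]
      refine Metric.diam_le_of_forall_dist_le (by positivity) fun x hx y hy => ?_
      rw [le_div_iff₀ hr, mul_comm, ← hf]
      exact Metric.dist_le_diam_of_mem (C.isCompact_cell (n + 1) b).isBounded
        (he ▸ ⟨x, hx, rfl⟩) (he ▸ ⟨y, hy, rfl⟩)

lemma measureReal_cell (n : ℕ) (b : Branch ω) : C.measure.real (C.cell n b) = branchMass b n := by
  rw [measureReal_def, C.measure_cell, ENNReal.toReal_prod]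
  exact Finset.prod_congr rfl fun i _ => ENNReal.toReal_ofReal (prob_pos _ _).le

/-- Points whose branches differ before step `n` are at distance at least `τ * scale ω n`. -/
lemma le_dist_point {n : ℕ} {b b' : Branch ω} (h : ∃ i < n, b' i ≠ b i) :
    S.τ * scale ω n ≤ dist (C.point b') (C.point b) := by
  classical
  obtain ⟨hi, hne⟩ := Nat.find_spec h
  have hmin : ∀ k < Nat.find h, b' k = b k := by
    intro k hk
    by_contra hc
    exact Nat.find_min h hk ⟨hk.trans hi, hc⟩
  set i := Nat.find h
  have e1 : C.cell (i + 1) b = C.cell (i + 1) (Function.update b i (b i)) := by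
    rw [Function.update_eq_self]
  have e2 : C.cell (i + 1) b' = C.cell (i + 1) (Function.update b i (b' i)) := by
    refine C.cell_congr _ _ _ fun k hk => ?_
    rcases Nat.lt_succ_iff_lt_or_eq.1 hk with hk | rfl
    · rw [Function.update_of_ne hk.ne, hmin k hk]
    · rw [Function.update_self]
  have hd := (C.children i b).2 (b' i) (b i) hne _ (e2.subset (C.point_mem b' (i + 1))) _
    (e1.subset (C.point_mem b (i + 1)))
  refine le_trans ?_ hd
  -- At the first disagreement `i` the separation is `τ * scale ω (i + 1)`, and `i + 1 ≤ n`.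
  rw [C.diam_cell, mul_assoc, mul_comm (ratio _), ← scale_succ]
  exact mul_le_mul_of_nonneg_left ((scale_strictAnti ω).antitone hi) S.τ_pos.le

/-- A coded point in the ball is too close to the centre for its branch to split off before step
`n`, so it lies in the same cell. -/
lemma measureReal_ball_le {n : ℕ} {R : ℝ} (b : Branch ω) (h : R ≤ S.τ * scale ω n) :
    C.measure.real (Metric.ball (C.point b) R) ≤ branchMass b n := by
  rw [← C.measureReal_cell, measureReal_def, measureReal_def]
  refine ENNReal.toReal_mono (measure_ne_top _ _) ?_
  rw [measure, Measure.map_apply C.continuous_point.measurable Metric.isOpen_ball.measurableSet,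
    Measure.map_apply C.continuous_point.measurable (C.isCompact_cell n b).measurableSet]
  refine measure_mono fun b' hb' => ?_
  have hb' : dist (C.point b') (C.point b) < R := hb'
  have hcong : C.cell n b' = C.cell n b := by
    refine C.cell_congr _ _ _ fun i hi => ?_
    by_contra hne
    exact absurd (C.le_dist_point ⟨i, hi, hne⟩) (not_le.2 (hb'.trans_le h))
  exact hcong ▸ C.point_mem b' n

lemma le_measureReal_ball {n : ℕ} {R : ℝ} (b : Branch ω) (h : scale ω n < R) :
    branchMass b n ≤ C.measure.real (Metric.ball (C.point b) R) := by
  rw [← C.measureReal_cell]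
  refine measureReal_mono fun y hy => ?_
  refine (Metric.dist_le_diam_of_mem (C.isCompact_cell n b).isBounded hy
    (C.point_mem b n)).trans_lt ?_
  rwa [C.diam_cell]

lemma measureReal_ball_pos (b : Branch ω) {R : ℝ} (hR : 0 < R) :
    0 < C.measure.real (Metric.ball (C.point b) R) := by
  obtain ⟨n, hn⟩ := ((tendsto_scale ω).eventually (gt_mem_nhds hR)).exists
  exact (branchMass_pos b n).trans_le (C.le_measureReal_ball b hn)

lemma point_mem_support (b : Branch ω) : C.point b ∈ C.measure.support := by
  rw [C.support_measure]
  exact Set.mem_iInter.2 fun n => Set.mem_iUnion.2 ⟨b, C.point_mem b n⟩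

lemma exists_point_eq {x : EuclideanSpace ℝ (Fin D)} (hx : x ∈ C.measure.support) :
    ∃ b, C.point b = x := by
  have hclosed : IsClosed (Set.range C.point) := (isCompact_range C.continuous_point).isClosed
  by_contra hxE
  refine ((Measure.mem_support_iff_forall _).1 hx _ (hclosed.isOpen_compl.mem_nhds hxE)).ne' ?_
  rw [measure, Measure.map_apply C.continuous_point.measurable hclosed.measurableSet.compl,
    Set.preimage_compl, Set.preimage_range, Set.compl_univ, measure_empty]

end Construction

end MoranData

/-! ### Comparison of `Φ`-dimensions with Assouad dimensions. -/

section PhiDimension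

variable {X : Type*} [PseudoMetricSpace X] [MeasurableSpace X]

/-- Radii admissible for `Φ` satisfy `r < R`, because `R ^ (1 + Φ R) ≤ R` is among the constraints;
hence exponents that work for `Φ = 0` work for every `Φ`. -/
lemma upperPhiDim_le_assouadDim (Φ : ℝ → ℝ) (μ : Measure X) : upperPhiDim Φ μ ≤ assouadDim μ := by
  refine sInf_le_sInf (Set.image_mono ?_)
  rintro d ⟨C₁, C₂, h₁, h₁', h₂, h⟩
  refine ⟨C₁, C₂, h₁, h₁', h₂, fun r R hr hrR hRR hR hRC => h r R hr ?_ ?_ hR hRC⟩ <;>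
    simp only [add_zero, Real.rpow_one]
  exacts [hrR.trans_le hRR, le_rfl]

lemma lowerAssouadDim_le_lowerPhiDim (Φ : ℝ → ℝ) (μ : Measure X) :
    lowerAssouadDim μ ≤ lowerPhiDim Φ μ := by
  refine sSup_le_sSup (Set.image_mono ?_)
  rintro d ⟨C₁, C₂, h₁, h₁', h₂, h⟩
  refine ⟨C₁, C₂, h₁, h₁', h₂, fun r R hr hrR hRR hR hRC => h r R hr ?_ ?_ hR hRC⟩ <;>
    simp only [add_zero, Real.rpow_one]
  exacts [hrR.trans_le hRR, le_rfl]

lemma assouadDim_le {μ : Measure X} {d C₁ C₂ : ℝ} (h₁ : 0 < C₁) (h₁' : C₁ < 1) (h₂ : 0 < C₂)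
    (h : ∀ r R : ℝ, 0 < r → r < R → R ≤ C₁ → ∀ x ∈ μ.support,
      μ.real (Metric.ball x R) / μ.real (Metric.ball x r) ≤ C₂ * (R / r) ^ d) :
    assouadDim μ ≤ d := by
  refine sInf_le ⟨d, ⟨C₁, C₂, h₁, h₁', h₂, fun r R hr hrR hRR hR hRC => h r R hr ?_ hRC⟩, rfl⟩
  simpa using hrR

lemma le_lowerAssouadDim {μ : Measure X} {d C₁ C₂ : ℝ} (h₁ : 0 < C₁) (h₁' : C₁ < 1) (h₂ : 0 < C₂)
    (h : ∀ r R : ℝ, 0 < r → r < R → R ≤ C₁ → ∀ x ∈ μ.support,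
      C₂ * (R / r) ^ d ≤ μ.real (Metric.ball x R) / μ.real (Metric.ball x r)) :
    (d : EReal) ≤ lowerAssouadDim μ := by
  refine le_sSup ⟨d, ⟨C₁, C₂, h₁, h₁', h₂, fun r R hr hrR hRR hR hRC => h r R hr ?_ hRC⟩, rfl⟩
  simpa using hrR

end PhiDimension

/-! ### Uniform Assouad bounds when the ratios are bounded below. -/

namespace MoranData

variable {D : ℕ} {S : MoranData D}

lemma exists_scale_lt_le (ω : ℕ → S.Omega₀) {x : ℝ} (hx : 0 < x) (hx1 : x ≤ 1) :
    ∃ n, scale ω (n + 1) < x ∧ x ≤ scale ω n := by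
  classical
  have h : ∃ n, scale ω n < x := ((tendsto_scale ω).eventually (gt_mem_nhds hx)).exists
  have h0 : Nat.find h ≠ 0 := fun h0 => by
    have := Nat.find_spec h
    rw [h0, scale_zero] at this
    linarith
  obtain ⟨n, hn⟩ := Nat.exists_eq_succ_of_ne_zero h0
  exact ⟨n, by simpa only [hn] using Nat.find_spec h, not_lt.1 (Nat.find_min h (by omega))⟩

/-- The cross-multiplied form lets the induction multiply the one-step inequalities without
divisions. -/
lemma branchMass_mul_scale_rpow_le {ω : ℕ → S.Omega₀} (b : Branch ω) {a : ℝ} {n m : ℕ}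
    (hnm : n ≤ m) (h : ∀ i, n ≤ i → i < m → ratio (ω i) ^ a ≤ prob (ω i) (b i)) :
    branchMass b n * scale ω m ^ a ≤ branchMass b m * scale ω n ^ a := by
  induction m, hnm using Nat.le_induction with
  | base => exact le_rfl
  | succ m hnm ih =>
    have ih := ih fun i hi him => h i hi (him.trans m.lt_succ_self)
    have e : branchMass b (m + 1) = branchMass b m * prob (ω m) (b m) := Finset.prod_range_succ _ _
    rw [e, scale_succ, Real.mul_rpow (scale_pos _ _).le (ratio_pos _).le, ← mul_assoc,
      mul_right_comm (branchMass b m)]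
    exact mul_le_mul ih (h m hnm m.lt_succ_self) (Real.rpow_nonneg (ratio_pos _).le _)
      (mul_nonneg (branchMass_pos b m).le (Real.rpow_nonneg (scale_pos _ _).le _))

lemma le_branchMass_mul_scale_rpow {ω : ℕ → S.Omega₀} (b : Branch ω) {a : ℝ} {n m : ℕ}
    (hnm : n ≤ m) (h : ∀ i, n ≤ i → i < m → prob (ω i) (b i) ≤ ratio (ω i) ^ a) :
    branchMass b m * scale ω n ^ a ≤ branchMass b n * scale ω m ^ a := by
  induction m, hnm using Nat.le_induction with
  | base => exact le_rfl
  | succ m hnm ih =>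
    have ih := ih fun i hi him => h i hi (him.trans m.lt_succ_self)
    have e : branchMass b (m + 1) = branchMass b m * prob (ω m) (b m) := Finset.prod_range_succ _ _
    rw [e, scale_succ, Real.mul_rpow (scale_pos _ _).le (ratio_pos _).le, ← mul_assoc,
      mul_right_comm (branchMass b m)]
    exact mul_le_mul ih (h m hnm m.lt_succ_self) (prob_pos _ _).le
      (mul_nonneg (branchMass_pos b n).le (Real.rpow_nonneg (scale_pos _ _).le _))

lemma branchMass_div_le {ω : ℕ → S.Omega₀} (b : Branch ω) {a : ℝ} {n m : ℕ}
    (hnm : n ≤ m) (h : ∀ i, n ≤ i → i < m → ratio (ω i) ^ a ≤ prob (ω i) (b i)) :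
    branchMass b n / branchMass b m ≤ (scale ω n / scale ω m) ^ a := by
  rw [Real.div_rpow (scale_pos _ _).le (scale_pos _ _).le, div_le_div_iff₀ (branchMass_pos _ _)
    (Real.rpow_pos_of_pos (scale_pos _ _) _), mul_comm (_ ^ a) (branchMass b m)]
  exact branchMass_mul_scale_rpow_le b hnm h

lemma le_branchMass_div {ω : ℕ → S.Omega₀} (b : Branch ω) {a : ℝ} {n m : ℕ}
    (hnm : n ≤ m) (h : ∀ i, n ≤ i → i < m → prob (ω i) (b i) ≤ ratio (ω i) ^ a) :
    (scale ω n / scale ω m) ^ a ≤ branchMass b n / branchMass b m := by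
  rw [Real.div_rpow (scale_pos _ _).le (scale_pos _ _).le,
    div_le_div_iff₀ (Real.rpow_pos_of_pos (scale_pos _ _) _) (branchMass_pos _ _),
    mul_comm (_ ^ a) (branchMass b m)]
  exact le_branchMass_mul_scale_rpow b hnm h

lemma log_div_log_ratio_le_iff (w : S.Omega₀) {p a : ℝ} (hp : 0 < p) :
    Real.log p / Real.log (ratio w) ≤ a ↔ ratio w ^ a ≤ p := by
  rw [div_le_iff_of_neg (log_ratio_neg w), Real.rpow_def_of_pos (ratio_pos w),
    ← Real.le_log_iff_exp_le hp, mul_comm]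

lemma le_log_div_log_ratio_iff (w : S.Omega₀) {p a : ℝ} (hp : 0 < p) :
    a ≤ Real.log p / Real.log (ratio w) ↔ p ≤ ratio w ^ a := by
  rw [le_div_iff_of_neg (log_ratio_neg w), Real.rpow_def_of_pos (ratio_pos w),
    ← Real.log_le_iff_le_exp hp, mul_comm]

namespace Construction

variable {ω : ℕ → S.Omega₀} (C : Construction ω)

lemma assouadDim_measure_le {ρ a : ℝ} (hρ : 0 < ρ) (ha : 0 ≤ a) (hr : ∀ n, ρ ≤ ratio (ω n))
    (hm : ∀ n, ratio (ω n) ^ a ≤ minProb (ω n)) : assouadDim C.measure ≤ a := by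
  have hτ := S.τ_pos
  -- Rounding each of `R / τ` and `r` to a scale costs a factor `ρ`; the separation costs `τ`.
  refine assouadDim_le (C₁ := S.τ) (C₂ := (1 / (S.τ * ρ * ρ)) ^ a) hτ S.τ_lt_one
    (by positivity) fun r R h0 hrR hRτ x hx => ?_
  obtain ⟨b, rfl⟩ := C.exists_point_eq hx
  have hR : 0 < R := h0.trans hrR
  obtain ⟨n, hn, hn'⟩ := exists_scale_lt_le ω (div_pos hR hτ) ((div_le_one hτ).2 hRτ)
  obtain ⟨k, hk, hk'⟩ := exists_scale_lt_le ω h0 (by linarith [S.τ_lt_one])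
  have hnk : n ≤ k + 1 := by
    refine ((scale_strictAnti ω).lt_iff_gt.1 ?_).le
    have : R ≤ R / S.τ := le_div_self hR.le hτ S.τ_lt_one.le
    linarith
  have hs := scale_pos ω (k + 1)
  calc _ ≤ branchMass b n / branchMass b (k + 1) :=
        div_le_div₀ (branchMass_pos _ _).le (C.measureReal_ball_le b (by rwa [← div_le_iff₀' hτ]))
          (branchMass_pos _ _) (C.le_measureReal_ball b hk)
    _ ≤ (scale ω n / scale ω (k + 1)) ^ a :=
        branchMass_div_le b hnk fun i _ _ => (hm i).trans (minProb_le _ _)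
    _ ≤ (1 / (S.τ * ρ * ρ) * (R / r)) ^ a := by
        refine Real.rpow_le_rpow (div_pos (scale_pos _ _) hs).le ?_ ha
        have e1 : scale ω n ≤ R / S.τ / ρ := by
          rw [le_div_iff₀ hρ]
          refine le_trans ?_ hn.le
          rw [scale_succ]
          exact mul_le_mul_of_nonneg_left (hr n) (scale_pos _ _).le
        have e2 : r * ρ ≤ scale ω (k + 1) := by
          rw [scale_succ]
          exact mul_le_mul hk' (hr k) hρ.le (scale_pos _ _).le
        calc _ ≤ (R / S.τ / ρ) / (r * ρ) := div_le_div₀ (by positivity) e1 (by positivity) e2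
          _ = _ := by field_simp
    _ = _ := Real.mul_rpow (by positivity) (by positivity)

/-- The exponent `0` is admissible by monotonicity of the measure alone. This covers nonpositive
exponents and ratios that are not bounded below. -/
lemma zero_le_lowerAssouadDim_measure : 0 ≤ lowerAssouadDim C.measure := by
  refine le_lowerAssouadDim (d := 0) (C₁ := 1 / 2) (C₂ := 1) (by norm_num) (by norm_num) one_pos
    fun r R h0 hrR hRτ x hx => ?_
  obtain ⟨b, rfl⟩ := C.exists_point_eq hx
  rw [Real.rpow_zero, mul_one, one_le_div (C.measureReal_ball_pos b h0)]
  exact measureReal_mono (Metric.ball_subset_ball hrR.le)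

lemma le_lowerAssouadDim_measure {ρ a : ℝ} (hρ : 0 < ρ) (ha : 0 ≤ a) (hr : ∀ n, ρ ≤ ratio (ω n))
    (hm : ∀ n, maxProb (ω n) ≤ ratio (ω n) ^ a) : (a : EReal) ≤ lowerAssouadDim C.measure := by
  have hτ := S.τ_pos
  refine le_lowerAssouadDim (C₁ := S.τ) (C₂ := (S.τ * ρ * ρ) ^ a) hτ S.τ_lt_one
    (by positivity) fun r R h0 hrR hRτ x hx => ?_
  obtain ⟨b, rfl⟩ := C.exists_point_eq hx
  have hR : 0 < R := h0.trans hrR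
  obtain ⟨n, hn, hn'⟩ := exists_scale_lt_le ω (div_pos h0 hτ)
    ((div_le_one hτ).2 (hrR.le.trans hRτ))
  obtain ⟨k, hk, hk'⟩ := exists_scale_lt_le ω hR (by linarith [S.τ_lt_one])
  have e1 : scale ω n ≤ r / S.τ / ρ := by
    rw [le_div_iff₀ hρ]
    refine le_trans ?_ hn.le
    rw [scale_succ]
    exact mul_le_mul_of_nonneg_left (hr n) (scale_pos _ _).le
  have e2 : R * ρ ≤ scale ω (k + 1) := by
    rw [scale_succ]
    exact mul_le_mul hk' (hr k) hρ.le (scale_pos _ _).le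
  have e3 : S.τ * ρ * ρ * (R / r) ≤ scale ω (k + 1) / scale ω n := by
    calc _ = (R * ρ) / (r / S.τ / ρ) := by field_simp
      _ ≤ _ := div_le_div₀ (scale_pos _ _).le e2 (scale_pos _ _) e1
  rw [← Real.mul_rpow (by positivity) (by positivity)]
  refine (Real.rpow_le_rpow (by positivity) e3 ha).trans ?_
  -- For comparable radii the cell inside the large ball may be no coarser than the one around the
  -- small ball; then the left side is at most `1` and monotonicity suffices.
  rcases le_total (k + 1) n with hkn | hkn
  · calc _ ≤ branchMass b (k + 1) / branchMass b n :=
        le_branchMass_div b hkn fun i _ _ => (le_maxProb _ _).trans (hm i)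
      _ ≤ _ := div_le_div₀ measureReal_nonneg (C.le_measureReal_ball b hk)
        (C.measureReal_ball_pos b h0) (C.measureReal_ball_le b (by rwa [← div_le_iff₀' hτ]))
  · calc _ ≤ (1 : ℝ) := Real.rpow_le_one (div_pos (scale_pos _ _) (scale_pos _ _)).le
          ((div_le_one (scale_pos _ _)).2 ((scale_strictAnti ω).antitone hkn)) ha
      _ ≤ _ := (one_le_div (C.measureReal_ball_pos b h0)).2
        (measureReal_mono (Metric.ball_subset_ball hrR.le))

end Construction

end MoranData

/-! ### Long runs from the second Borel–Cantelli lemma. -/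

/-- Almost every sequence of independent samples contains, infinitely often, runs in a given
set of positive measure whose length is at least logarithmic in their position. -/
lemma exists_ae_frequently_run {X : Type*} [MeasurableSpace X] (π : Measure X)
    [IsProbabilityMeasure π] {G : Set X} (hG : MeasurableSet G) (h0 : π G ≠ 0) :
    ∃ s : ℝ, 0 < s ∧ ∀ᵐ ω ∂(Measure.infinitePi fun _ : ℕ => π),
      ∃ᶠ n : ℕ in atTop, ∃ L : ℕ, (n : ℝ) ^ s ≤ 2 ^ (L + 1) ∧ ∀ i, n ≤ i → i < n + L → ω i ∈ G := by
  classical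
  have hq : 0 < π.real G := ENNReal.toReal_pos h0 (measure_ne_top _ _)
  obtain ⟨a, ha⟩ := exists_pow_lt_of_lt_one hq (by norm_num : (1 / 2 : ℝ) < 1)
  -- A power of `2` with `1 / B ≤ π G`; the exponent `a + 1` keeps `B > 1` even if `a = 0`.
  set B : ℕ := 2 ^ (a + 1) with hB
  have hB1 : 1 < B := Nat.one_lt_two_pow (by omega)
  have hBq : (B : ℝ)⁻¹ ≤ π.real G := by
    refine le_trans ?_ ha.le
    rw [hB, Nat.cast_pow, Nat.cast_ofNat, ← inv_pow, ← one_div]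
    exact pow_le_pow_of_le_one (by norm_num) (by norm_num) a.le_succ
  -- With this length a run has probability at least `B ^ (-L k) ≥ 1 / (k + 1)`, so the series
  -- diverges. Starting the blocks at `k ^ 2` makes them disjoint, since `L k ≤ k`, hence
  -- independent.
  set L : ℕ → ℕ := fun k => Nat.log B (k + 1) with hL
  have hLk : ∀ k, L k ≤ k := fun k => Nat.lt_succ_iff.1 (Nat.log_lt_self B k.succ_ne_zero)
  set I : ℕ → Finset ℕ := fun k => Finset.Ico (k ^ 2) (k ^ 2 + L k) with hI
  set P := Measure.infinitePi fun _ : ℕ => π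
  set E : ℕ → Set (ℕ → X) := fun k => Set.pi (I k) fun _ => G with hE
  have hEm : ∀ k, MeasurableSet (E k) := fun k =>
    MeasurableSet.pi (I k).countable_toSet fun _ _ => hG
  have hpi : ∀ s : Finset ℕ, P (Set.pi s fun _ => G) = ∏ _i ∈ s, π G := fun s =>
    Measure.infinitePi_pi _ fun _ _ => hG
  have hdisj : Pairwise (Function.onFun Disjoint I) := by
    have key : ∀ k l, k < l → Disjoint (I k) (I l) := by
      intro k l hkl
      rw [Finset.disjoint_left]
      intro i hi hi'
      rw [hI, Finset.mem_Ico] at hi hi'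
      have := hLk k
      nlinarith
    intro k l hkl
    rcases lt_or_gt_of_ne hkl with h | h
    exacts [key k l h, (key l k h).symm]
  have hindep : ProbabilityTheory.iIndepSet E P := by
    rw [ProbabilityTheory.iIndepSet_iff_meas_biInter hEm]
    intro s
    have e : (⋂ k ∈ s, E k) = Set.pi (s.biUnion I : Finset ℕ) fun _ => G := by
      ext ω
      simp only [hE, Set.mem_iInter, Set.mem_pi, Finset.mem_coe, Finset.mem_biUnion]
      exact ⟨fun h i ⟨k, hk, hi⟩ => h k hk i hi, fun h k hk i hi => h i ⟨k, hk, hi⟩⟩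
    rw [e, hpi, Finset.prod_biUnion fun k _ l _ hkl => hdisj hkl]
    exact Finset.prod_congr rfl fun k _ => (hpi (I k)).symm
  have hsum : ∑' k, P (E k) = ⊤ := by
    by_contra hne
    have h1 := ENNReal.summable_toReal hne
    have h2 : Summable fun k : ℕ => 1 / ((k + 1 : ℕ) : ℝ) := by
      refine h1.of_nonneg_of_le (fun k => by positivity) fun k => ?_
      have e : (P (E k)).toReal = π.real G ^ L k := by
        rw [hE]
        simp only
        rw [hpi, ENNReal.toReal_prod, Finset.prod_const, hI]
        simp [measureReal_def]
      rw [e]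
      refine le_trans ?_ (pow_le_pow_left₀ (by positivity) hBq _)
      rw [inv_pow, one_div]
      refine inv_anti₀ (by positivity) ?_
      exact_mod_cast Nat.pow_log_le_self B k.succ_ne_zero
    exact Real.not_summable_one_div_natCast
      ((summable_nat_add_iff (f := fun n : ℕ => 1 / (n : ℝ)) 1).1 h2)
  have hlim := ProbabilityTheory.measure_limsup_eq_one hEm hindep hsum
  have hae : ∀ᵐ ω ∂P, ω ∈ limsup E atTop :=
    (mem_ae_iff_prob_eq_one (MeasurableSet.measurableSet_limsup hEm)).2 hlim
  -- From `k ≤ B ^ (L k + 1)` the position `n = k ^ 2` is at most `2 ^ (2 * (a + 1) * (L k + 1))`;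
  -- this exponent extracts the root.
  refine ⟨1 / (2 * ((a + 1 : ℕ) : ℝ)), by positivity, ?_⟩
  filter_upwards [hae] with ω hω
  rw [mem_limsup_iff_frequently_mem] at hω
  have ht : Tendsto (fun k : ℕ => k ^ 2) atTop atTop := tendsto_pow_atTop two_ne_zero
  refine ht.frequently (hω.mono fun k hk => ⟨L k, ?_, fun i hi hi' =>
    hk i (Finset.mem_coe.2 (Finset.mem_Ico.2 ⟨hi, hi'⟩))⟩)
  have h1 : ((k : ℝ) ^ 2) ≤ ((2 ^ (L k + 1)) ^ (a + 1)) ^ 2 := by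
    refine pow_le_pow_left₀ (by positivity) ?_ 2
    have := (Nat.lt_pow_succ_log_self hB1 (k + 1)).le
    rw [hB, ← pow_mul, mul_comm, pow_mul] at this
    exact_mod_cast (Nat.le_succ k).trans this
  rw [Nat.cast_pow]
  refine (Real.rpow_le_rpow (by positivity) h1 (by positivity)).trans (le_of_eq ?_)
  rw [← pow_mul, ← Real.rpow_natCast, ← Real.rpow_mul (by positivity)]
  have : (((a + 1) * 2 : ℕ) : ℝ) * (1 / (2 * ((a + 1 : ℕ) : ℝ))) = 1 := by
    push_cast
    field_simp
  rw [this, Real.rpow_one]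

/-! ### Measurability and the almost sure size of the scales. -/

lemma measurable_sigma_of_forall {ι : Type*} {Y : ι → Type*} {Z : Type*}
    [∀ i, MeasurableSpace (Y i)] [MeasurableSpace Z] {f : (Σ i, Y i) → Z}
    (hf : ∀ i, Measurable fun y : Y i => f ⟨i, y⟩) : Measurable f :=
  fun _ hs => MeasurableSpace.measurableSet_iInf.2 fun i => hf i hs

namespace MoranData

variable {D : ℕ} {S : MoranData D}

lemma measurable_ratio : Measurable (ratio : S.Omega₀ → ℝ) :=
  measurable_sigma_of_forall fun _ => measurable_fst.comp measurable_subtype_coe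

lemma measurable_minProb : Measurable (minProb : S.Omega₀ → ℝ) :=
  measurable_sigma_of_forall fun t => by
    have h : Measurable fun y : S.OmegaT t => ⨅ j : Fin t, y.1.2 j := Measurable.iInf fun j =>
      (measurable_pi_apply j).comp (measurable_snd.comp measurable_subtype_coe)
    exact h

lemma measurable_maxProb : Measurable (maxProb : S.Omega₀ → ℝ) :=
  measurable_sigma_of_forall fun t => by
    have h : Measurable fun y : S.OmegaT t => ⨆ j : Fin t, y.1.2 j := Measurable.iSup fun j =>
      (measurable_pi_apply j).comp (measurable_snd.comp measurable_subtype_coe)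
    exact h

/-- The strong law gives a linear bound, with integrability from `A * x ≤ exp (A * x)`; any
polynomial bound would serve, and `n ^ 2` absorbs the unknown constant. -/
lemma ae_eventually_neg_log_scale_le (π : Measure S.Omega₀) [IsProbabilityMeasure π]
    {A : ℝ} (hA : 0 < A) (h : Integrable (fun w => Real.exp (A * -Real.log (ratio w))) π) :
    ∀ᵐ ω ∂(Measure.infinitePi fun _ : ℕ => π),
      ∀ᶠ n : ℕ in atTop, -Real.log (scale ω n) ≤ (n : ℝ) ^ 2 := by
  have hm : Measurable fun w : S.Omega₀ => -Real.log (ratio w) :=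
    (Real.measurable_log.comp measurable_ratio).neg
  have hint : Integrable (fun w => -Real.log (ratio w)) π := by
    refine (h.div_const A).mono' hm.aestronglyMeasurable (ae_of_all _ fun w => ?_)
    rw [Real.norm_of_nonneg (neg_nonneg.2 (log_ratio_neg w).le), le_div_iff₀' hA]
    exact (le_add_of_nonneg_right zero_le_one).trans (Real.add_one_le_exp _)
  have hP := fun i : ℕ => measurePreserving_eval_infinitePi (fun _ : ℕ => π) i
  have hind := ProbabilityTheory.iIndepFun_infinitePi (P := fun _ : ℕ => π) fun _ => hm
  have hslln := ProbabilityTheory.strong_law_ae_real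
    (μ := Measure.infinitePi fun _ : ℕ => π)
    (fun (i : ℕ) (ω : ℕ → S.Omega₀) => -Real.log (ratio (ω i)))
    ((hP 0).integrable_comp_of_integrable hint) (fun i j hij => hind.indepFun hij) fun i =>
      ⟨(hm.comp (measurable_pi_apply i)).aemeasurable,
        (hm.comp (measurable_pi_apply 0)).aemeasurable, by
          have e : ∀ i : ℕ, Measure.map (fun ω : ℕ → S.Omega₀ => -Real.log (ratio (ω i)))
              (Measure.infinitePi fun _ : ℕ => π)
              = π.map fun w => -Real.log (ratio w) := fun i => by
            have := Measure.map_map (μ := Measure.infinitePi fun _ : ℕ => π) hm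
              (measurable_pi_apply i)
            rw [(hP i).map_eq] at this
            exact this.symm
          rw [e i, e 0]⟩
  filter_upwards [hslln] with ω hω
  obtain ⟨c, hc⟩ : ∃ c : ℝ, ∀ᶠ n : ℕ in atTop,
      (∑ i ∈ Finset.range n, -Real.log (ratio (ω i))) / n < c :=
    ⟨_, hω.eventually (gt_mem_nhds (lt_add_one _))⟩
  filter_upwards [hc, eventually_gt_atTop 0, eventually_ge_atTop ⌈c⌉₊] with n hn hn0 hnc
  have hn0' : (0 : ℝ) < n := Nat.cast_pos.2 hn0
  rw [scale, Real.log_prod fun i _ => (ratio_pos _).ne', ← Finset.sum_neg_distrib]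
  rw [div_lt_iff₀ hn0'] at hn
  have := (Nat.le_ceil c).trans (Nat.cast_le.2 hnc)
  nlinarith

end MoranData

/-! ### Small dimension functions and admissible radii along runs. -/

lemma IsSmall.eventually_le_rpow {Φ : ℝ → ℝ} (h : IsSmall Φ) (hΦ : IsDimensionFunction Φ)
    {ε : ℝ} (hε : 0 < ε) :
    ∀ᶠ R in 𝓝[>] (0 : ℝ), R * (-Real.log R) ^ (-ε) ≤ R ^ (1 + Φ R) := by
  obtain ⟨A, δ, hδ, hA, hle⟩ := h
  have h1 : ∀ᶠ R in 𝓝[>] (0 : ℝ), R < δ := nhdsWithin_le_nhds (gt_mem_nhds hδ)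
  have h2 : ∀ᶠ R in 𝓝[>] (0 : ℝ), R < 1 := nhdsWithin_le_nhds (gt_mem_nhds one_pos)
  filter_upwards [h1, h2, self_mem_nhdsWithin, hA.eventually_ge_atTop (1 / ε)] with R hRδ hR1 hR hAR
  have hR : 0 < R := hR
  have hlog : 0 < -Real.log R := neg_pos.2 (Real.log_neg hR hR1)
  have hΦR := hΦ.1 R ⟨hR, hR1⟩
  have h3 := hle R hR hRδ hR1
  simp only [abs_of_neg (Real.log_neg hR hR1)] at h3
  rw [le_div_iff₀ hlog] at h3
  have h4 : 1 / ε * Φ R * -Real.log R ≤ Real.log (-Real.log R) :=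
    le_trans (mul_le_mul_of_nonneg_right (mul_le_mul_of_nonneg_right hAR hΦR) hlog.le) h3
  -- Exponentiated, this is `R ^ Φ R ≥ (-log R) ^ (-ε)`.
  have h5 : Φ R * -Real.log R ≤ ε * Real.log (-Real.log R) := by
    calc Φ R * -Real.log R = ε * (1 / ε * Φ R * -Real.log R) := by field_simp
      _ ≤ _ := mul_le_mul_of_nonneg_left h4 hε.le
  rw [Real.rpow_add hR, Real.rpow_one]
  refine mul_le_mul_of_nonneg_left ?_ hR.le
  rw [Real.rpow_def_of_pos hlog, Real.rpow_def_of_pos hR, Real.exp_le_exp]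
  linarith

namespace MoranData

variable {D : ℕ} {S : MoranData D}

/-- Long runs in `G` realise pairs of radii that are admissible for every small `Φ`. -/
lemma exists_run_of_isSmall {ω : ℕ → S.Omega₀}
    (hω : ∀ᶠ n : ℕ in atTop, -Real.log (scale ω n) ≤ (n : ℝ) ^ 2)
    {G : Set S.Omega₀} {s : ℝ} (hs : 0 < s)
    (hG : ∃ᶠ n : ℕ in atTop, ∃ L : ℕ, (n : ℝ) ^ s ≤ 2 ^ (L + 1) ∧
      ∀ i, n ≤ i → i < n + L → ω i ∈ G)
    {Φ : ℝ → ℝ} (hΦ : IsDimensionFunction Φ) (h : IsSmall Φ)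
    {c₁ c₂ δ : ℝ} (hc₁ : 0 < c₁) (hc₂ : 0 < c₂) (hδ : 0 < δ) (Q : ℝ) :
    ∃ n L : ℕ, (∀ i, n ≤ i → i < n + L → ω i ∈ G) ∧ c₁ * scale ω n ≤ δ ∧
      c₂ * scale ω (n + L) < (c₁ * scale ω n) ^ (1 + Φ (c₁ * scale ω n)) ∧
      (c₁ * scale ω n) ^ (1 + Φ (c₁ * scale ω n)) ≤ c₁ * scale ω n ∧
      Q ≤ scale ω n / scale ω (n + L) := by
  have hpos : ∀ n, 0 < c₁ * scale ω n := fun n => mul_pos hc₁ (scale_pos ω n)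
  have ht : Tendsto (fun n => c₁ * scale ω n) atTop (𝓝 0) := by
    simpa using (tendsto_scale ω).const_mul c₁
  have ht' : Tendsto (fun n => c₁ * scale ω n) atTop (𝓝[>] 0) :=
    tendsto_nhdsWithin_iff.2 ⟨ht, Eventually.of_forall hpos⟩
  have hpow : ∀ {p : ℝ}, 0 < p → Tendsto (fun n : ℕ => (n : ℝ) ^ p) atTop atTop := fun hp =>
    (tendsto_rpow_atTop hp).comp tendsto_natCast_atTop_atTop
  -- With `R = c₁ * scale ω n` and `-log R ≤ n ^ 3`, the loss from `Φ` is at most `n ^ (s / 2)`. The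
  -- run gains `n ^ s / 2`, and the spare `n ^ (s / 2)` absorbs `c₁` and `c₂` through `e5`.
  have e1 := ht'.eventually (h.eventually_le_rpow hΦ (ε := s / 6) (by positivity))
  have e2 := ht.eventually (gt_mem_nhds hδ)
  have e3 := ht.eventually (gt_mem_nhds one_pos)
  have e4 := (hpow hs).eventually_ge_atTop (2 * Q)
  have e5 := (hpow (half_pos hs)).eventually_gt_atTop (2 * c₂ / c₁)
  have e6 : ∀ᶠ n : ℕ in atTop, (2 + |Real.log c₁| : ℝ) ≤ n :=
    tendsto_natCast_atTop_atTop.eventually_ge_atTop _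
  obtain ⟨n, ⟨L, hL, hrun⟩, h0, h1, h2, h3, h4, h5, h6⟩ :=
    (hG.and_eventually (hω.and (e1.and (e2.and (e3.and (e4.and (e5.and e6))))))).exists
  have hn : (0 : ℝ) < n := by linarith [abs_nonneg (Real.log c₁)]
  have hR := hpos n
  have hsn := scale_pos ω n
  have hsL := scale_pos ω (n + L)
  have hL2 : (n : ℝ) ^ s ≤ 2 * 2 ^ L := by rwa [pow_succ'] at hL
  have hsc : 2 ^ L ≤ scale ω n / scale ω (n + L) := by
    rw [le_div_iff₀ hsL, mul_comm]
    exact scale_add_le ω n L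
  refine ⟨n, L, hrun, h2.le, ?_, ?_, by linarith⟩
  · refine lt_of_lt_of_le ?_ h1
    have hlogpos : 0 < -Real.log (c₁ * scale ω n) := neg_pos.2 (Real.log_neg hR h3)
    have hlog : -Real.log (c₁ * scale ω n) ≤ (n : ℝ) ^ (3 : ℝ) := by
      have e7 : (n : ℝ) ^ (3 : ℝ) = (n : ℝ) ^ 3 := by exact_mod_cast Real.rpow_natCast n 3
      rw [Real.log_mul hc₁.ne' hsn.ne', e7]
      have := neg_abs_le (Real.log c₁)
      have h7 := abs_nonneg (Real.log c₁)
      have h8 : (n : ℝ) * n ≥ n := by nlinarith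
      have h9 : (n : ℝ) ^ 3 ≥ (2 + |Real.log c₁|) * (n : ℝ) ^ 2 := by
        rw [pow_succ' (n : ℝ) 2]
        exact mul_le_mul_of_nonneg_right h6 (by positivity)
      have h10 : |Real.log c₁| ≤ |Real.log c₁| * (n : ℝ) ^ 2 :=
        le_mul_of_one_le_right h7 (by nlinarith)
      nlinarith [sq_nonneg (n : ℝ)]
    have hlow : (n : ℝ) ^ (-(s / 2)) ≤ (-Real.log (c₁ * scale ω n)) ^ (-(s / 6)) := by
      calc (n : ℝ) ^ (-(s / 2)) = ((n : ℝ) ^ (3 : ℝ)) ^ (-(s / 6)) := by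
            rw [← Real.rpow_mul hn.le]
            congr 1
            ring
        _ ≤ _ := Real.rpow_le_rpow_of_nonpos hlogpos hlog (by linarith)
    refine lt_of_lt_of_le ?_ (mul_le_mul_of_nonneg_left hlow hR.le)
    set y := (n : ℝ) ^ (s / 2) with hy
    have hy0 : 0 < y := Real.rpow_pos_of_pos hn _
    have hyy : (n : ℝ) ^ s = y * y := by
      rw [hy, ← Real.rpow_add hn]
      congr 1
      ring
    rw [Real.rpow_neg hn.le, ← hy, ← div_eq_mul_inv, lt_div_iff₀ hy0]
    rw [div_lt_iff₀ hc₁] at h5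
    have h11 : y * y * scale ω (n + L) ≤ 2 * scale ω n := by
      rw [← hyy]
      have := scale_add_le ω n L
      calc _ ≤ 2 * 2 ^ L * scale ω (n + L) := mul_le_mul_of_nonneg_right hL2 hsL.le
        _ ≤ _ := by linarith
    have h12 : c₂ * scale ω (n + L) * y * y ≤ 2 * c₂ * scale ω n := by
      have := mul_le_mul_of_nonneg_left h11 hc₂.le
      linarith
    have h13 : 2 * c₂ * scale ω n < y * c₁ * scale ω n := mul_lt_mul_of_pos_right h5 hsn
    refine lt_of_mul_lt_mul_right ?_ hy0.le
    linarith
  · conv_rhs => rw [← Real.rpow_one (c₁ * scale ω n)]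
    exact Real.rpow_le_rpow_of_exponent_ge hR h3.le
      (le_add_of_nonneg_right (hΦ.1 _ ⟨hR, h3⟩))

namespace Construction

variable {ω : ℕ → S.Omega₀} (C : Construction ω)

lemma lowerPhiDim_measure_le
    (hω : ∀ᶠ n : ℕ in atTop, -Real.log (scale ω n) ≤ (n : ℝ) ^ 2) {s a : ℝ} (hs : 0 < s)
    (hG : ∃ᶠ n : ℕ in atTop, ∃ L : ℕ, (n : ℝ) ^ s ≤ 2 ^ (L + 1) ∧
      ∀ i, n ≤ i → i < n + L → Real.log (maxProb (ω i)) / Real.log (ratio (ω i)) ≤ a)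
    {Φ : ℝ → ℝ} (hΦ : IsDimensionFunction Φ) (h : IsSmall Φ) :
    lowerPhiDim Φ C.measure ≤ a := by
  have hτ := S.τ_pos
  refine sSup_le ?_
  rintro _ ⟨d, ⟨C₁, C₂, h₁, -, h₂, hd⟩, rfl⟩
  refine EReal.coe_le_coe_iff.2 (not_lt.1 fun had => ?_)
  -- The branch through the heaviest children has the slowest mass decay.
  choose b hb using fun i => exists_prob_eq_maxProb (ω i)
  -- For `R = τ * scale ω n`, `r = 2 * scale ω (n + L)` and `q = scale ω n / scale ω (n + L)`, an
  -- admissible `d > a` would force `C₂ * (τ / 2 * q) ^ d ≤ q ^ a`, which fails once `q ≥ Q`.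
  obtain ⟨Q, hQ⟩ := eventually_atTop.1 ((tendsto_rpow_atTop (sub_pos.2 had)).eventually_gt_atTop
    (1 / (C₂ * (S.τ / 2) ^ d)))
  obtain ⟨n, L, hrun, hR, hr, hRR, hq⟩ := exists_run_of_isSmall hω hs
    (G := {w | Real.log (maxProb w) / Real.log (ratio w) ≤ a}) hG hΦ h hτ two_pos h₁ Q
  have hsn := scale_pos ω n
  have hsL := scale_pos ω (n + L)
  set q := scale ω n / scale ω (n + L) with hqdef
  have hq0 : 0 < q := div_pos hsn hsL
  have h3 := hd _ _ (by positivity) hr hRR (by positivity) hR _ (C.point_mem_support b)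
  have h4 := h3.trans (div_le_div₀ (branchMass_pos b n).le (C.measureReal_ball_le b le_rfl)
    (branchMass_pos b (n + L)) (C.le_measureReal_ball b (by linarith)))
  have h5 := h4.trans (branchMass_div_le b (Nat.le_add_right n L) (a := a) fun i hi hi' => by
    rw [hb, ← log_div_log_ratio_le_iff _ (maxProb_pos _)]
    exact hrun i hi hi')
  have e : S.τ * scale ω n / (2 * scale ω (n + L)) = S.τ / 2 * q := by
    rw [hqdef]
    field_simp
  rw [← hqdef, e, Real.mul_rpow (by positivity) hq0.le] at h5
  have h6 := hQ q hq
  rw [Real.rpow_sub hq0, div_lt_div_iff₀ (by positivity) (by positivity)] at h6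
  linarith

lemma le_upperPhiDim_measure
    (hω : ∀ᶠ n : ℕ in atTop, -Real.log (scale ω n) ≤ (n : ℝ) ^ 2) {s a : ℝ} (hs : 0 < s)
    (hG : ∃ᶠ n : ℕ in atTop, ∃ L : ℕ, (n : ℝ) ^ s ≤ 2 ^ (L + 1) ∧
      ∀ i, n ≤ i → i < n + L → a ≤ Real.log (minProb (ω i)) / Real.log (ratio (ω i)))
    {Φ : ℝ → ℝ} (hΦ : IsDimensionFunction Φ) (h : IsSmall Φ) :
    (a : EReal) ≤ upperPhiDim Φ C.measure := by
  have hτ := S.τ_pos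
  refine le_sInf ?_
  rintro _ ⟨d, ⟨C₁, C₂, h₁, -, h₂, hd⟩, rfl⟩
  refine EReal.coe_le_coe_iff.2 (not_lt.1 fun had => ?_)
  choose b hb using fun i => exists_prob_eq_minProb (ω i)
  -- Dually, with `R = 2 * scale ω n`, `r = τ * scale ω (n + L)` and the lightest children, `d < a`
  -- would give `q ^ a ≤ C₂ * (2 / τ * q) ^ d`.
  obtain ⟨Q, hQ⟩ := eventually_atTop.1 ((tendsto_rpow_atTop (sub_pos.2 had)).eventually_gt_atTop
    (C₂ * (2 / S.τ) ^ d))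
  obtain ⟨n, L, hrun, hR, hr, hRR, hq⟩ := exists_run_of_isSmall hω hs
    (G := {w | a ≤ Real.log (minProb w) / Real.log (ratio w)}) hG hΦ h two_pos hτ h₁ Q
  have hsn := scale_pos ω n
  have hsL := scale_pos ω (n + L)
  set q := scale ω n / scale ω (n + L) with hqdef
  have hq0 : 0 < q := div_pos hsn hsL
  have h3 := hd _ _ (by positivity) hr hRR (by positivity) hR _ (C.point_mem_support b)
  have h4 := (div_le_div₀ measureReal_nonneg (C.le_measureReal_ball (n := n) b (by linarith))
    (C.measureReal_ball_pos b (by positivity)) (C.measureReal_ball_le b le_rfl)).trans h3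
  have h5 := (le_branchMass_div b (Nat.le_add_right n L) (a := a) fun i hi hi' => by
    rw [hb, ← le_log_div_log_ratio_iff _ (minProb_pos _)]
    exact hrun i hi hi').trans h4
  have e : 2 * scale ω n / (S.τ * scale ω (n + L)) = 2 / S.τ * q := by
    rw [hqdef]
    field_simp
  rw [← hqdef, e, Real.mul_rpow (by positivity) hq0.le] at h5
  have h6 := hQ q hq
  rw [Real.rpow_sub hq0, lt_div_iff₀ (by positivity)] at h6
  linarith

end Construction

/-! ### Almost sure bounds by `α` and `β`. -/

section AlmostSure

lemma ae_forall_coord {X : Type*} [MeasurableSpace X] (ν : Measure X) [IsProbabilityMeasure ν]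
    {p : X → Prop} (h : ∀ᵐ w ∂ν, p w) : ∀ᵐ ω ∂(Measure.infinitePi fun _ : ℕ => ν), ∀ n, p (ω n) :=
  ae_all_iff.2 fun n =>
    (measurePreserving_eval_infinitePi (fun _ : ℕ => ν) n).quasiMeasurePreserving.ae h

variable (π : Measure S.Omega₀)

lemma exists_pos_ae_le_ratio (h : 0 < essInf (fun w : S.Omega₀ => ratio w) π) :
    ∃ ρ : ℝ, 0 < ρ ∧ ∀ᵐ w ∂π, ρ ≤ ratio w := by
  rw [essInf, liminf_eq] at h
  by_contra hne
  -- The real `essInf` is the `sSup` of the almost sure lower bounds; `Real.sSup_nonpos` needs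
  -- neither boundedness nor nonemptiness.
  refine absurd h (not_lt.2 (Real.sSup_nonpos fun a ha => ?_))
  by_contra! ha0
  exact hne ⟨a, ha0, ha⟩

/-- With boundedly many children, `β` vanishes as soon as the ratios are not bounded below. -/
lemma beta_nonpos_of_T_le {K : ℕ} (hK : ∀ᵐ w ∂π, T w ≤ K)
    (hr : ∀ ρ : ℝ, 0 < ρ → ¬ ∀ᵐ w ∂π, ρ ≤ ratio w) : beta π ≤ 0 := by
  refine EReal.le_of_forall_lt_iff_le.1 fun z hz => ?_
  have hz : 0 < z := EReal.coe_pos.1 hz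
  by_contra! hlt
  -- If `β > z > 0` then `1 / K ≤ maxProb w < ratio w ^ z`, which bounds the ratio below by `K ^ (-1
  -- / z)`.
  refine hr (Real.exp (-(Real.log K / z))) (Real.exp_pos _) ?_
  filter_upwards [hK, ae_lt_of_lt_essInf hlt] with w hw hzw
  have hzw := EReal.coe_lt_coe_iff.1 hzw
  have hM := maxProb_pos w
  have hT : (0 : ℝ) < T w := Nat.cast_pos.2 ((two_le_T w).trans_lt' (by norm_num))
  have h1 : 0 ≤ Real.log K + Real.log (maxProb w) := by
    have hK0 : (0 : ℝ) < K := hT.trans_le (Nat.cast_le.2 hw)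
    rw [← Real.log_mul hK0.ne' hM.ne']
    exact Real.log_nonneg ((one_le_T_mul_maxProb w).trans
      (mul_le_mul_of_nonneg_right (Nat.cast_le.2 hw) hM.le))
  rw [lt_div_iff_of_neg (log_ratio_neg w)] at hzw
  rw [← Real.le_log_iff_exp_le (ratio_pos w), neg_le, le_div_iff₀ hz]
  linarith

variable [IsProbabilityMeasure π]

lemma ae_lowerPhiDim_le_beta {A : ℝ} (hA : 0 < A)
    (hint : Integrable (fun w => Real.exp (A * -Real.log (ratio w))) π) :
    ∀ᵐ ω ∂(Measure.infinitePi fun _ : ℕ => π), ∀ C : Construction ω,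
      ∀ Φ : ℝ → ℝ, IsDimensionFunction Φ → IsSmall Φ → lowerPhiDim Φ C.measure ≤ beta π := by
  -- Rational thresholds leave countably many null sets, chosen before the construction and `Φ`.
  have hruns : ∀ z : ℚ, ∀ᵐ ω ∂(Measure.infinitePi fun _ : ℕ => π), beta π < ((z : ℝ) : EReal) →
      ∃ s : ℝ, 0 < s ∧ ∃ᶠ n : ℕ in atTop, ∃ L : ℕ, (n : ℝ) ^ s ≤ 2 ^ (L + 1) ∧
        ∀ i, n ≤ i → i < n + L → Real.log (maxProb (ω i)) / Real.log (ratio (ω i)) ≤ z := by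
    intro z
    by_cases hz : beta π < ((z : ℝ) : EReal)
    · have hG : MeasurableSet
          {w : S.Omega₀ | Real.log (maxProb w) / Real.log (ratio w) ≤ z} :=
        measurableSet_le ((Real.measurable_log.comp measurable_maxProb).div
          (Real.measurable_log.comp measurable_ratio)) measurable_const
      obtain ⟨s, hs, h⟩ := exists_ae_frequently_run π hG fun h0 => by
        refine absurd (le_essInf_of_ae_le ((z : ℝ) : EReal) ?_) (not_le.2 hz)
        filter_upwards [measure_eq_zero_iff_ae_notMem.1 h0] with w hw
        exact EReal.coe_le_coe_iff.2 (not_le.1 hw).le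
      exact h.mono fun ω hω _ => ⟨s, hs, hω⟩
    · exact ae_of_all _ fun ω h => absurd h hz
  filter_upwards [ae_all_iff.2 hruns, ae_eventually_neg_log_scale_le π hA hint] with ω hω hω' C Φ
    hΦ hsmall
  refine le_of_forall_gt_imp_ge_of_dense fun y hy => ?_
  obtain ⟨z, hz, hzy⟩ := EReal.lt_iff_exists_rat_btwn.1 hy
  obtain ⟨s, hs, hrun⟩ := hω z hz
  exact (C.lowerPhiDim_measure_le hω' hs hrun hΦ hsmall).trans hzy.le

lemma ae_alpha_le_upperPhiDim {A : ℝ} (hA : 0 < A)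
    (hint : Integrable (fun w => Real.exp (A * -Real.log (ratio w))) π) :
    ∀ᵐ ω ∂(Measure.infinitePi fun _ : ℕ => π), ∀ C : Construction ω,
      ∀ Φ : ℝ → ℝ, IsDimensionFunction Φ → IsSmall Φ → alpha π ≤ upperPhiDim Φ C.measure := by
  have hruns : ∀ z : ℚ, ∀ᵐ ω ∂(Measure.infinitePi fun _ : ℕ => π), ((z : ℝ) : EReal) < alpha π →
      ∃ s : ℝ, 0 < s ∧ ∃ᶠ n : ℕ in atTop, ∃ L : ℕ, (n : ℝ) ^ s ≤ 2 ^ (L + 1) ∧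
        ∀ i, n ≤ i → i < n + L → z ≤ Real.log (minProb (ω i)) / Real.log (ratio (ω i)) := by
    intro z
    by_cases hz : ((z : ℝ) : EReal) < alpha π
    · have hG : MeasurableSet
          {w : S.Omega₀ | z ≤ Real.log (minProb w) / Real.log (ratio w)} :=
        measurableSet_le measurable_const ((Real.measurable_log.comp measurable_minProb).div
          (Real.measurable_log.comp measurable_ratio))
      obtain ⟨s, hs, h⟩ := exists_ae_frequently_run π hG fun h0 => by
        refine absurd (essSup_le_of_ae_le ((z : ℝ) : EReal) ?_) (not_le.2 hz)
        filter_upwards [measure_eq_zero_iff_ae_notMem.1 h0] with w hw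
        exact EReal.coe_le_coe_iff.2 (not_le.1 hw).le
      exact h.mono fun ω hω _ => ⟨s, hs, hω⟩
    · exact ae_of_all _ fun ω h => absurd h hz
  filter_upwards [ae_all_iff.2 hruns, ae_eventually_neg_log_scale_le π hA hint] with ω hω hω' C Φ
    hΦ hsmall
  refine le_of_forall_lt_imp_le_of_dense fun y hy => ?_
  obtain ⟨z, hyz, hz⟩ := EReal.lt_iff_exists_rat_btwn.1 hy
  obtain ⟨s, hs, hrun⟩ := hω z hz
  exact hyz.le.trans (C.le_upperPhiDim_measure hω' hs hrun hΦ hsmall)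

lemma ae_beta_le_lowerAssouadDim {ρ : ℝ} (hρ : 0 < ρ) (hr : ∀ᵐ w ∂π, ρ ≤ ratio w) :
    ∀ᵐ ω ∂(Measure.infinitePi fun _ : ℕ => π), ∀ C : Construction ω,
      beta π ≤ lowerAssouadDim C.measure := by
  have hβ : ∀ᵐ w ∂π, beta π ≤ ((Real.log (maxProb w) / Real.log (ratio w) : ℝ) : EReal) :=
    ae_essInf_le
  filter_upwards [ae_forall_coord π hr, ae_forall_coord π hβ] with ω hω hωβ C
  refine EReal.ge_of_forall_gt_iff_ge.1 fun z hz => ?_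
  -- The uniform bound needs a nonnegative exponent, since it compares powers of different bases.
  rcases le_total z 0 with hz0 | hz0
  · exact (EReal.coe_nonpos.2 hz0).trans C.zero_le_lowerAssouadDim_measure
  · refine C.le_lowerAssouadDim_measure hρ hz0 hω fun n => ?_
    rw [← le_log_div_log_ratio_iff _ (maxProb_pos _)]
    exact EReal.coe_le_coe_iff.1 (hz.le.trans (hωβ n))

lemma ae_assouadDim_le_alpha {ρ : ℝ} (hρ : 0 < ρ) (hr : ∀ᵐ w ∂π, ρ ≤ ratio w) :
    ∀ᵐ ω ∂(Measure.infinitePi fun _ : ℕ => π), ∀ C : Construction ω,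
      assouadDim C.measure ≤ alpha π := by
  have hα : ∀ᵐ w ∂π, ((Real.log (minProb w) / Real.log (ratio w) : ℝ) : EReal) ≤ alpha π :=
    ae_le_essSup
  filter_upwards [ae_forall_coord π hr, ae_forall_coord π hα] with ω hω hωα C
  -- If `α = ⊤` there is no such real `z`, and the bound is vacuous.
  refine EReal.le_of_forall_lt_iff_le.1 fun z hz => ?_
  have hle : ∀ n, Real.log (minProb (ω n)) / Real.log (ratio (ω n)) ≤ z := fun n =>
    EReal.coe_le_coe_iff.1 ((hωα n).trans hz.le)
  have hz0 : 0 ≤ z := le_trans (div_nonneg_of_nonpos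
    (Real.log_neg (minProb_pos _) (minProb_lt_one _)).le (log_ratio_neg _).le) (hle 0)
  refine C.assouadDim_measure_le hρ hz0 hω fun n => ?_
  rw [← log_div_log_ratio_le_iff _ (minProb_pos _)]
  exact hle n

end AlmostSure

end MoranData

/-! ### Closing the chains of inequalities. -/

theorem mainTheorem4 {D : ℕ} (S : MoranData D) (π : Measure S.Omega₀) [IsProbabilityMeasure π]
    (hbasic : ∃ A : ℝ, 0 < A ∧ ∀ l : ℝ, |l| ≤ A →
      Integrable (fun w => Real.exp (l * -Real.log (MoranData.ratio w))) π) :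
    (0 < essInf (fun w => MoranData.ratio w) π →
      ∀ᵐ ω ∂(Measure.infinitePi fun _ : ℕ => π), ∀ C : MoranData.Construction ω,
        ∀ Φ : ℝ → ℝ, IsDimensionFunction Φ → IsSmall Φ →
          (lowerPhiDim Φ C.measure = lowerAssouadDim C.measure ∧
            lowerAssouadDim C.measure = MoranData.beta π) ∧
          (upperPhiDim Φ C.measure = assouadDim C.measure ∧
            assouadDim C.measure = MoranData.alpha π)) ∧
    ((∃ K : ℕ, ∀ᵐ w ∂π, MoranData.T w ≤ K) →
      ∀ᵐ ω ∂(Measure.infinitePi fun _ : ℕ => π), ∀ C : MoranData.Construction ω,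
        ∀ Φ : ℝ → ℝ, IsDimensionFunction Φ → IsSmall Φ →
          lowerPhiDim Φ C.measure = lowerAssouadDim C.measure ∧
            lowerAssouadDim C.measure = MoranData.beta π) := by
  obtain ⟨A, hA, hint⟩ := hbasic
  have hint := hint A (abs_of_pos hA).le
  have hlow := MoranData.ae_lowerPhiDim_le_beta π hA hint
  have huniform : ∀ ρ : ℝ, 0 < ρ → (∀ᵐ w ∂π, ρ ≤ MoranData.ratio w) →
      ∀ᵐ ω ∂(Measure.infinitePi fun _ : ℕ => π), ∀ C : MoranData.Construction ω,
        ∀ Φ : ℝ → ℝ, IsDimensionFunction Φ → IsSmall Φ →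
          lowerPhiDim Φ C.measure = lowerAssouadDim C.measure ∧
            lowerAssouadDim C.measure = MoranData.beta π := by
    intro ρ hρ hr
    filter_upwards [hlow, MoranData.ae_beta_le_lowerAssouadDim π hρ hr] with ω h1 h2 C Φ hΦ hs
    have h3 := lowerAssouadDim_le_lowerPhiDim Φ C.measure
    exact ⟨((h1 C Φ hΦ hs).trans (h2 C)).antisymm h3, (h3.trans (h1 C Φ hΦ hs)).antisymm (h2 C)⟩
  refine ⟨fun hess => ?_, fun ⟨K, hK⟩ => ?_⟩
  · obtain ⟨ρ, hρ, hr⟩ := MoranData.exists_pos_ae_le_ratio π hess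
    filter_upwards [huniform ρ hρ hr, MoranData.ae_alpha_le_upperPhiDim π hA hint,
      MoranData.ae_assouadDim_le_alpha π hρ hr] with ω h1 h2 h3 C Φ hΦ hs
    have h4 := upperPhiDim_le_assouadDim Φ C.measure
    exact ⟨h1 C Φ hΦ hs, h4.antisymm ((h3 C).trans (h2 C Φ hΦ hs)),
      (h3 C).antisymm ((h2 C Φ hΦ hs).trans h4)⟩
  · by_cases hr : ∃ ρ : ℝ, 0 < ρ ∧ ∀ᵐ w ∂π, ρ ≤ MoranData.ratio w
    · obtain ⟨ρ, hρ, hr⟩ := hr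
      exact huniform ρ hρ hr
    -- Here `β ≤ 0 ≤ dim_L ≤ lowerPhiDim ≤ β`, so all of these vanish.
    · have hβ := MoranData.beta_nonpos_of_T_le π hK fun ρ hρ h => hr ⟨ρ, hρ, h⟩
      filter_upwards [hlow] with ω h1 C Φ hΦ hs
      have h2 := hβ.trans C.zero_le_lowerAssouadDim_measure
      have h3 := lowerAssouadDim_le_lowerPhiDim Φ C.measure
      exact ⟨((h1 C Φ hΦ hs).trans h2).antisymm h3, (h3.trans (h1 C Φ hΦ hs)).antisymm h2⟩
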